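/- A partition is a weakly decreasing, eventually zero sequence $\lambda=(\lambda_1,\lambda_2,\dots)$ of nonnegative integers, with size $|\lambda|=\sum_i\lambda_i$; it is strict if $\lambda_i>\lambda_{i+1}$ whenever $\lambda_i\neq 0$. Sums of partitions are taken part by part; $\delta_n:=(n,n-1,\dots,1)$ and $b^a:=(b,\dots,b)$ ($a$ copies). A partition $\nu$ whose height (number of nonzero parts) and width ($\nu_1$) are both equal to $k$ is called balanced if every outward corner of the southeast border of its Young diagram (a north step followed by an east step, when the border is traversed from the southwest end to the northeast end) occurs at a point of the main anti-diagonal; equivalently, $\nu_{i+1}=k-i$ for all $1\le i<k$ with $\nu_i>\nu_{i+1}$. (The empty partition is balanced, with $k=0$.) A strict partition $\lambda$ is *shifted-balanced of Type (1)* if $\lambda=\delta_n+\nu$, and *of Type (2)* if $\lambda=\delta_n+\nu+(n-1-k)^n$, for some integers $0\le k<n$ and some balanced partition $\nu$ of height and width $k$. The shifted Young diagram of $\lambda$ consists of the boxes $[i,j]$ with $\lambda_i>0$ and $i\le j\le i+\lambda_i-1$. A *shifted set-valued tableau* $T$ of shape $\lambda$ assigns to each box $u$ a finite nonempty subset $T(u)$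 of the totally ordered set $1<1'<2<2'<\cdots$, such that $\max T(u)\le\min T(v)$ whenever $u\ne v$ and $v$ is weakly southeast of $u$; each unprimed integer appears at most once in each column; and each primed integer appears at most once in each row. Let $\mathbf{x}^T$ be the monomial with a factor $x_i$ for each occurrence of $i$ or $i'$ in $T$, and let $|T|$ be its degree. $T$ is *standard* if $\mathbf{x}^T=x_1x_2\cdots x_N$ for some $N$, and *barely set-valued* if $\#T(u)=1$ for all boxes $u$ except for a unique box $u_0$ with $\#T(u_0)=2$. Let $g^\lambda$ be the number of standard shifted set-valued tableaux of shape $\lambda$ in which every box holds exactly one entry and no primed integer appears. Let $GQ_\lambda:=\sum_T(-1)^{|T|-|\lambda|}\mathbf{x}^T$, the sum over all shifted set-valued tableaux $T$ of shape $\lambda$. **Corollary.** Let $\lambda$ be a strict partition that is shifted-balanced of Type (1) or Type (2). Then the number of standard shifted barely set-valued tableaux of shape $\lambda$ is $$(\lambda_1+1)\,(|\lambda|+1)\,2^{|\lambda|-1}\,g^\lambda,$$ and this number is $-1$ times the coefficient of $x_1x_2\cdots x_{|\lambda|+1}$ in $GQ_\lambda$. -/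

import Mathlib

open scoped BigOperators

namespace ShiftedTableaux

/-! Partitions are Young diagrams: `lam.rowLen i` is the part with index `i + 1` (rows are
numbered from `0`), `lam.card` is the size and `lam.colLen 0` is the length. The cell `(p, q)`
is the box `[p + 1, q + 1]` in matrix coordinates. -/

/-- A partition is strict if its nonzero parts strictly decrease. -/
def IsStrict (lam : YoungDiagram) : Prop :=
  ∀ i, lam.rowLen i ≠ 0 → lam.rowLen (i + 1) < lam.rowLen i

/-- The parts `n, n - 1, …, 1, 0, 0, …` of the staircase of length `n`. -/
def staircase (n : ℕ) (i : ℕ) : ℕ := n - i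

/-- The parts `b, …, b, 0, 0, …` (`a` copies of `b`) of the `a × b` rectangle. -/
def rectangle (a b : ℕ) (i : ℕ) : ℕ := if i < a then b else 0

/-- The height of a straight shape: the number of its nonempty rows. -/
def height (nu : YoungDiagram) : ℕ := nu.colLen 0

/-- The width of a straight shape: its first part. -/
def width (nu : YoungDiagram) : ℕ := nu.rowLen 0

/-- An outward corner of the straight shape `nu` occurs at the lattice point `(i, j)`: the
southeast border takes a north step into `(i, j)` followed by an east step out of it. The north
step has the box `[i + 1, j]` of `nu` on its west side, the east step has the box `[i, j + 1]` of
`nu` on its north side, and `[i + 1, j + 1]` lies outside `nu`. (The northwest border of a straight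
shape has no outward corner.) -/
def OutwardCornerAt (nu : YoungDiagram) (i j : ℕ) : Prop :=
  1 ≤ i ∧ 1 ≤ j ∧ (i, j - 1) ∈ nu ∧ (i - 1, j) ∈ nu ∧ (i, j) ∉ nu

/-- A straight shape of height `a` and width `b` is balanced if all its outward corners occur on
the main anti-diagonal, the line through `(a, 0)` and `(0, b)`, that is `b * i + a * j = a * b`. -/
def IsBalanced (nu : YoungDiagram) : Prop :=
  ∀ i j, OutwardCornerAt nu i j →
    width nu * i + height nu * j = height nu * width nu

/-- `lam = δ_n + nu` with `0 ≤ k < n` and `nu` balanced of height and width `k`. -/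
def IsShiftedBalancedOne (lam : YoungDiagram) : Prop :=
  ∃ (n k : ℕ) (nu : YoungDiagram), k < n ∧ IsBalanced nu ∧ height nu = k ∧ width nu = k ∧
    ∀ i, lam.rowLen i = staircase n i + nu.rowLen i

/-- `lam = δ_n + nu + (n - 1 - k)^n` with `0 ≤ k < n` and `nu` balanced of height and
width `k`. -/
def IsShiftedBalancedTwo (lam : YoungDiagram) : Prop :=
  ∃ (n k : ℕ) (nu : YoungDiagram), k < n ∧ IsBalanced nu ∧ height nu = k ∧ width nu = k ∧
    ∀ i, lam.rowLen i = staircase n i + nu.rowLen i + rectangle n (n - 1 - k) i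

/-- The boxes of the shifted Young diagram: row `i` is indented by `i` boxes. The order inherited
from `ℕ × ℕ` is `u ≤ v` iff `v` is weakly southeast of `u`. -/
def shiftedCells (lam : YoungDiagram) : Finset (ℕ × ℕ) :=
  lam.cells.image fun c => (c.1, c.1 + c.2)

/-- The poset of boxes of the shifted Young diagram. -/
abbrev Box (lam : YoungDiagram) : Type := {c : ℕ × ℕ // c ∈ shiftedCells lam}

/-- The totally ordered alphabet `1 < 1' < 2 < 2' < ⋯`: positive integers with a prime flag, in
lexicographic order, where `false` (unprimed) comes before `true` (primed). -/
abbrev Entry : Type := ℕ+ ×ₗ Bool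

/-- The integer underlying a primed or unprimed entry. -/
def Entry.val (e : Entry) : ℕ+ := (ofLex e).1

/-- The entry carries a prime. -/
def Entry.IsPrimed (e : Entry) : Prop := (ofLex e).2 = true

/-- An assignment of a finite set of entries to each box. -/
abbrev Filling (lam : YoungDiagram) : Type := Box lam → Finset Entry

/-- The exponent vector of the monomial `x^T`; both `i` and `i'` contribute a factor `x_i`. -/
noncomputable def content {lam : YoungDiagram} (T : Filling lam) : ℕ+ →₀ ℕ :=
  ∑ u, ∑ e ∈ T u, Finsupp.single e.val 1

/-- The exponent vector of the monomial `x_1 x_2 ⋯ x_N`. -/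
noncomputable def prodContent (N : ℕ) : ℕ+ →₀ ℕ :=
  ∑ i ∈ Finset.range N, Finsupp.single i.succPNat 1

/-- Shifted set-valued tableaux. -/
structure IsTableau {lam : YoungDiagram} (T : Filling lam) : Prop where
  nonempty : ∀ u, (T u).Nonempty
  max_le_min : ∀ u v, u < v → ∀ a ∈ T u, ∀ b ∈ T v, a ≤ b
  column : ∀ e : Entry, ¬ e.IsPrimed → ∀ u v : Box lam, u.1.2 = v.1.2 → e ∈ T u → e ∈ T v → u = v
  row : ∀ e : Entry, e.IsPrimed → ∀ u v : Box lam, u.1.1 = v.1.1 → e ∈ T u → e ∈ T v → u = v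

/-- `x^T = x_1 x_2 ⋯ x_N` for some `N`. -/
def IsStandard {lam : YoungDiagram} (T : Filling lam) : Prop :=
  ∃ N, content T = prodContent N

/-- Every box holds exactly one entry. -/
def IsSingleValued {lam : YoungDiagram} (T : Filling lam) : Prop :=
  ∀ u, (T u).card = 1

/-- Every box holds exactly one entry, except for a unique box that holds two. -/
def IsBarelySetValued {lam : YoungDiagram} (T : Filling lam) : Prop :=
  ∃ u₀, (T u₀).card = 2 ∧ ∀ u, u ≠ u₀ → (T u).card = 1

/-- No primed integer appears. -/
def IsUnprimed {lam : YoungDiagram} (T : Filling lam) : Prop :=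
  ∀ u, ∀ e ∈ T u, ¬ e.IsPrimed

/-- The number of standard shifted barely set-valued tableaux of shape `lam`. -/
noncomputable def numBarely (lam : YoungDiagram) : ℕ :=
  {T : Filling lam | IsTableau T ∧ IsStandard T ∧ IsBarelySetValued T}.ncard

/-- `g^lam`, the number of unprimed standard shifted tableaux of shape `lam`. -/
noncomputable def numUnprimed (lam : YoungDiagram) : ℕ :=
  {T : Filling lam | IsTableau T ∧ IsStandard T ∧ IsSingleValued T ∧ IsUnprimed T}.ncard

theorem finite_content_eq (lam : YoungDiagram) (m : ℕ+ →₀ ℕ) :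
    {T : Filling lam | IsTableau T ∧ content T = m}.Finite := by
  classical
  set E : Finset Entry := (m.support ×ˢ (Finset.univ : Finset Bool)).image toLex with hE
  refine (Set.Finite.pi' (t := fun _ : Box lam => (E.powerset : Set (Finset Entry)))
    (fun _ => E.powerset.finite_toSet)).subset ?_
  rintro T ⟨-, hT⟩ u
  simp only [Finset.mem_coe, Finset.mem_powerset]
  intro e he
  have h1 : (1 : ℕ) ≤ m e.val := by
    rw [← hT]
    simp only [content, Finsupp.finsetSum_apply]
    calc (1 : ℕ) = (Finsupp.single e.val 1 : ℕ+ →₀ ℕ) e.val := by simp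
      _ ≤ ∑ f ∈ T u, (Finsupp.single f.val 1 : ℕ+ →₀ ℕ) e.val :=
        Finset.single_le_sum (f := fun f : Entry => (Finsupp.single f.val 1 : ℕ+ →₀ ℕ) e.val)
          (fun _ _ => Nat.zero_le _) he
      _ ≤ _ := Finset.single_le_sum
          (f := fun u => ∑ f ∈ T u, (Finsupp.single f.val 1 : ℕ+ →₀ ℕ) e.val)
          (fun _ _ => Nat.zero_le _) (Finset.mem_univ u)
  rw [hE, Finset.mem_image]
  refine ⟨ofLex e, ?_, rfl⟩
  simp only [Finset.mem_product, Finset.mem_univ, and_true, Finsupp.mem_support_iff]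
  exact Nat.one_le_iff_ne_zero.mp h1

/-- The formal power series `GQ_lam = ∑_T (-1)^(|T| - |lam|) x^T`, the sum over all shifted
set-valued tableaux `T` of shape `lam`, given by its coefficients; `|T|` is the degree of `x^T`
(and `|T| ≥ |lam|` since no box is empty). -/
noncomputable def GQ (lam : YoungDiagram) : MvPowerSeries ℕ+ ℤ := fun m =>
  ∑ T ∈ (finite_content_eq lam m).toFinset, (-1) ^ ((content T).degree - lam.card)

end ShiftedTableaux

namespace ShiftedTableaux

open Finset Function

/-! In a standard filling each integer occurs once, so the row and column conditions are vacuous and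
primes are free. Such a filling of degree `N` is therefore a word `σ`, with `σ i` the box holding
the integer `i + 1`, together with one of `2 ^ N` choices of primes. For `n = |λ|`, unprimed
single-valued tableaux are the words of length `n`, that is, linear extensions; barely set-valued
ones come from the words of length `n + 1`, in which exactly one box is repeated.

Cut a linear extension at one of `n + 1` places and let `I` be the order ideal before the cut.
Inserting `u` at the cut when `u` is maximal in `I` makes the later copy of a repeated `u`;
inserting it when `u` is minimal outside `I` makes the earlier copy. Both operations are bijections
onto the words repeating `u` (`card_isDouble_eq_card_maximal`, `card_isDouble_eq_card_minimal`).
Hence, over all pairs of a word and a cut, each signed toggleability statistic sums to zero, while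
the number of maximal elements of `I` sums to the number of words of length `n + 1`.

It remains to write four times the number of maximal elements of `I`, plus a combination of
toggleability statistics, as the constant `λ₁ + 1` (`sum_maximal_sub_sum_minimal`). The identity
telescopes over rows. Balancedness enters only to make the weights vanish at the addable corners of
`λ`, where no box exists to be toggled in. Then `card_isWord_succ` gives the count, the factor 4
turning `2 ^ (n + 1)` into `2 ^ (n - 1)`. -/

/-- Words containing every element of a poset, in an order compatible with it. -/
def IsWord {P : Type*} [PartialOrder P] {N : ℕ} (σ : Fin N → P) : Prop :=
  Surjective σ ∧ ∀ i j, i < j → ¬ σ j < σ i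

/-- The set of the first `j` letters of a word. -/
def prefixSet {P : Type*} {n : ℕ} (w : Fin n → P) (j : Fin (n + 1)) : Set P :=
  {u | ∃ i : Fin n, j.succAbove i < j ∧ w i = u}

/-- The letter `u` occurs at two positions of `σ`. -/
def IsDouble {P : Type*} {N : ℕ} (σ : Fin N → P) (u : P) : Prop :=
  ∃ a b, a < b ∧ σ a = u ∧ σ b = u

theorem exists_isDouble {P : Type*} [Fintype P] {n : ℕ}
    (hP : Fintype.card P = n) (σ : Fin (n + 1) → P) :
    ∃ u, IsDouble σ u := by
  obtain ⟨a, b, hne, h⟩ := Fintype.exists_ne_map_eq_of_card_lt σ (by simp [hP])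
  rcases lt_or_gt_of_ne hne with hlt | hlt
  · exact ⟨σ b, a, b, hlt, h, rfl⟩
  · exact ⟨σ a, b, a, hlt, h.symm, rfl⟩

/-! ### Words in a finite poset: linear extensions and words with one repeated letter. -/

section Words

variable {P : Type*} [PartialOrder P] {n : ℕ}

theorem IsWord.isLowerSet_prefixSet {w : Fin n → P} (hw : IsWord w) (j : Fin (n + 1)) :
    IsLowerSet (prefixSet w j) := by
  rintro u v hvu ⟨i, hij, rfl⟩
  rcases hvu.eq_or_lt with rfl | h
  · exact ⟨i, hij, rfl⟩
  · obtain ⟨k, rfl⟩ := hw.1 v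
    refine ⟨k, ?_, rfl⟩
    have hki : k < i := by
      by_contra hk
      rcases (not_lt.mp hk).eq_or_lt with rfl | h'
      · exact lt_irrefl _ h
      · exact hw.2 i k h' h
    exact (Fin.succAbove_lt_succAbove_iff.mpr hki).trans hij

theorem IsWord.removeNth {σ : Fin (n + 1) → P} (hσ : IsWord σ) {a b : Fin (n + 1)} (hab : a ≠ b)
    (h : σ a = σ b) : IsWord (b.removeNth σ) := by
  refine ⟨fun v => ?_, fun i j hij => ?_⟩
  · obtain ⟨i, rfl⟩ := hσ.1 v
    rcases Fin.eq_self_or_eq_succAbove b i with rfl | ⟨k, rfl⟩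
    · obtain ⟨k, rfl⟩ := Fin.exists_succAbove_eq hab
      exact ⟨k, h⟩
    · exact ⟨k, rfl⟩
  · exact hσ.2 _ _ (Fin.succAbove_lt_succAbove_iff.mpr hij)

variable [Fintype P]

theorem IsWord.injective (hP : Fintype.card P = n) {w : Fin n → P} (hw : IsWord w) :
    Injective w :=
  ((Fintype.bijective_iff_surjective_and_card w).mpr ⟨hw.1, by simp [hP]⟩).1

theorem IsWord.insertNth (hP : Fintype.card P = n) {w : Fin n → P} (hw : IsWord w)
    (j : Fin (n + 1)) (u : P) (h1 : ∀ v ∈ prefixSet w j, ¬ u < v)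
    (h2 : ∀ v ∉ prefixSet w j, ¬ v < u) : IsWord (j.insertNth (α := fun _ => P) u w) := by
  refine ⟨fun v => ?_, fun a b hab => ?_⟩
  · obtain ⟨i, rfl⟩ := hw.1 v
    exact ⟨j.succAbove i, by simp⟩
  · rcases Fin.eq_self_or_eq_succAbove j a with ha | ⟨a, rfl⟩ <;>
      rcases Fin.eq_self_or_eq_succAbove j b with hb | ⟨b, rfl⟩
    · exact absurd hab (by simp [ha, hb])
    · subst ha
      simp only [Fin.insertNth_apply_same, Fin.insertNth_apply_succAbove]
      refine h2 _ ?_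
      rintro ⟨i, hi, hib⟩
      rw [hw.injective hP hib] at hi
      exact lt_asymm hi hab
    · subst hb
      simp only [Fin.insertNth_apply_same, Fin.insertNth_apply_succAbove]
      exact h1 _ ⟨a, hab, rfl⟩
    · simp only [Fin.insertNth_apply_succAbove]
      exact hw.2 _ _ (Fin.succAbove_lt_succAbove_iff.mp hab)

/-- Deleting either copy of a repeated letter leaves a surjective word of length `n`, hence an
injective one. So any coincidence must involve both deleted positions. -/
theorem eq_of_isDouble (hP : Fintype.card P = n) {σ : Fin (n + 1) → P} (hσ : IsWord σ)
    {a b c d : Fin (n + 1)} (hab : a < b) (h : σ a = σ b) (hcd : c < d) (h' : σ c = σ d) :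
    a = c ∧ b = d := by
  have hb := (hσ.removeNth hab.ne h).injective hP
  have ha := (hσ.removeNth hab.ne' h.symm).injective hP
  have key : ∀ {x y z : Fin (n + 1)}, Injective (x.removeNth σ) → σ y = σ z → y ≠ z →
      y = x ∨ z = x := by
    intro x y z hx hyz hne
    by_contra! hcon
    obtain ⟨y, rfl⟩ := Fin.exists_succAbove_eq hcon.1
    obtain ⟨z, rfl⟩ := Fin.exists_succAbove_eq hcon.2
    exact hne (congrArg _ (hx hyz))
  rcases key ha h' hcd.ne with rfl | rfl <;> rcases key hb h' hcd.ne with rfl | rfl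
  · exact absurd hab (lt_irrefl _)
  · exact ⟨rfl, rfl⟩
  · exact absurd hab (lt_asymm hcd)
  · exact absurd hab (lt_irrefl _)

-- Inserting `u` at the cut creates its second copy; the inverse deletes the later copy and records
-- its position as the cut. Compatibility forces everything between the two copies not to lie above
-- `u`, which is maximality in the prefix.
open Classical in
theorem card_isDouble_eq_card_maximal (hP : Fintype.card P = n) (u : P) :
    #{x : (Fin n → P) × Fin (n + 1) | IsWord x.1 ∧ Maximal (· ∈ prefixSet x.1 x.2) u} =
      #{σ : Fin (n + 1) → P | IsWord σ ∧ IsDouble σ u} := by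
  have hdbl : ∀ x : (Fin n → P) × Fin (n + 1), Maximal (· ∈ prefixSet x.1 x.2) u →
      ∃ a < x.2, x.2.insertNth (α := fun _ => P) u x.1 a = u := by
    rintro ⟨w, j⟩ ⟨⟨i, hi, rfl⟩, -⟩
    exact ⟨_, hi, by simp⟩
  have hword : ∀ x : (Fin n → P) × Fin (n + 1), IsWord x.1 →
      Maximal (· ∈ prefixSet x.1 x.2) u → IsWord (x.2.insertNth (α := fun _ => P) u x.1) := by
    rintro ⟨w, j⟩ hw hmax
    exact hw.insertNth hP j u (fun v hv => hmax.not_gt hv)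
      (fun v hv hvu => hv (hw.isLowerSet_prefixSet j hvu.le hmax.prop))
  refine Finset.card_bij (fun x _ => x.2.insertNth (α := fun _ => P) u x.1) ?_ ?_ ?_
  · intro x hx
    obtain ⟨hw, hmax⟩ := (mem_filter.mp hx).2
    obtain ⟨a, ha, hau⟩ := hdbl x hmax
    exact mem_filter.mpr ⟨mem_univ _, hword x hw hmax, a, x.2, ha, hau, by simp⟩
  · rintro ⟨w, j⟩ hx ⟨w', j'⟩ hx' heq
    obtain ⟨hw, hmax⟩ := (mem_filter.mp hx).2
    obtain ⟨hw', hmax'⟩ := (mem_filter.mp hx').2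
    obtain ⟨a, ha, hau⟩ := hdbl _ hmax
    obtain ⟨a', ha', hau'⟩ := hdbl _ hmax'
    dsimp only at *
    obtain ⟨-, rfl⟩ := eq_of_isDouble hP (hword (w, j) hw hmax) ha (by simpa using hau) ha'
      (by dsimp only; rw [heq]; simpa using hau')
    rw [Fin.insertNth_right_injective (α := fun _ => P) u heq]
  · intro σ hσ
    obtain ⟨hσ, a, b, hab, hau, hbu⟩ := (mem_filter.mp hσ).2
    obtain ⟨k, rfl⟩ := Fin.exists_succAbove_eq hab.ne
    refine ⟨(b.removeNth σ, b), mem_filter.mpr ⟨mem_univ _,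
      hσ.removeNth hab.ne (hau.trans hbu.symm), ⟨k, hab, hau⟩, ?_⟩, ?_⟩
    · rintro v ⟨i, hi, rfl⟩ huv
      by_contra hvu
      exact hσ.2 _ _ hi (hbu ▸ lt_of_le_not_ge huv hvu)
    · exact hbu ▸ Fin.insertNth_self_removeNth b σ

-- The mirror image: the inserted `u` is the earlier copy, and the inverse deletes that one.
open Classical in
theorem card_isDouble_eq_card_minimal (hP : Fintype.card P = n) (u : P) :
    #{x : (Fin n → P) × Fin (n + 1) | IsWord x.1 ∧ Minimal (· ∉ prefixSet x.1 x.2) u} =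
      #{σ : Fin (n + 1) → P | IsWord σ ∧ IsDouble σ u} := by
  have hdbl : ∀ x : (Fin n → P) × Fin (n + 1), IsWord x.1 → Minimal (· ∉ prefixSet x.1 x.2) u →
      ∃ b > x.2, x.2.insertNth (α := fun _ => P) u x.1 b = u := by
    rintro ⟨w, j⟩ hw ⟨hu, -⟩
    obtain ⟨i, rfl⟩ := hw.1 u
    exact ⟨_, lt_of_le_of_ne (not_lt.mp fun hi => hu ⟨i, hi, rfl⟩) (Fin.succAbove_ne _ _).symm,
      by simp⟩
  have hword : ∀ x : (Fin n → P) × Fin (n + 1), IsWord x.1 →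
      Minimal (· ∉ prefixSet x.1 x.2) u → IsWord (x.2.insertNth (α := fun _ => P) u x.1) := by
    rintro ⟨w, j⟩ hw hmin
    exact hw.insertNth hP j u (fun v hv huv => hmin.prop (hw.isLowerSet_prefixSet j huv.le hv))
      (fun v hv => hmin.not_lt hv)
  refine Finset.card_bij (fun x _ => x.2.insertNth (α := fun _ => P) u x.1) ?_ ?_ ?_
  · intro x hx
    obtain ⟨hw, hmin⟩ := (mem_filter.mp hx).2
    obtain ⟨b, hb, hbu⟩ := hdbl x hw hmin
    exact mem_filter.mpr ⟨mem_univ _, hword x hw hmin, x.2, b, hb, by simp, hbu⟩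
  · rintro ⟨w, j⟩ hx ⟨w', j'⟩ hx' heq
    obtain ⟨hw, hmin⟩ := (mem_filter.mp hx).2
    obtain ⟨hw', hmin'⟩ := (mem_filter.mp hx').2
    obtain ⟨b, hb, hbu⟩ := hdbl _ hw hmin
    obtain ⟨b', hb', hbu'⟩ := hdbl _ hw' hmin'
    dsimp only at *
    obtain ⟨rfl, -⟩ := eq_of_isDouble hP (hword (w, j) hw hmin) hb (by simpa using hbu.symm) hb'
      (by dsimp only; rw [heq]; simpa using hbu'.symm)
    rw [Fin.insertNth_right_injective (α := fun _ => P) u heq]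
  · intro σ hσ
    obtain ⟨hσ, a, b, hab, hau, hbu⟩ := (mem_filter.mp hσ).2
    obtain ⟨k, rfl⟩ := Fin.exists_succAbove_eq hab.ne'
    have hw := hσ.removeNth hab.ne' (hbu.trans hau.symm)
    refine ⟨(a.removeNth σ, a), mem_filter.mpr ⟨mem_univ _, hw, ?_, ?_⟩, ?_⟩
    · rintro ⟨i, hi, hiu⟩
      rw [hw.injective hP (hiu.trans hbu.symm)] at hi
      exact lt_asymm hi hab
    · intro v hv hvu
      by_contra huv
      obtain ⟨i, rfl⟩ := hw.1 v
      refine hσ.2 a (a.succAbove i) ?_ (hau ▸ lt_of_le_not_ge hvu huv)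
      exact lt_of_le_of_ne (not_lt.mp fun hi => hv ⟨i, hi, rfl⟩) (Fin.succAbove_ne _ _).symm
    · exact hau ▸ Fin.insertNth_self_removeNth a σ

open Classical in
theorem sum_card_isDouble (hP : Fintype.card P = n) :
    ∑ u : P, #{σ : Fin (n + 1) → P | IsWord σ ∧ IsDouble σ u} =
      #{σ : Fin (n + 1) → P | IsWord σ} := by
  choose f hf using exists_isDouble (P := P) hP
  rw [Finset.card_eq_sum_card_fiberwise (f := f) (t := univ) (fun _ _ => mem_univ _)]
  refine sum_congr rfl fun u _ => congrArg card ?_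
  ext σ
  simp only [mem_filter, mem_univ, true_and, and_congr_right_iff]
  refine fun hσ => ⟨fun ⟨a, b, hab, ha, hb⟩ => ?_, fun h => h ▸ hf σ⟩
  obtain ⟨c, d, hcd, hc, hd⟩ := hf σ
  obtain ⟨rfl, rfl⟩ := eq_of_isDouble hP hσ hab (ha.trans hb.symm) hcd (hc.trans hd.symm)
  exact hc.symm.trans ha

open Classical in
/-- If the down-degree of order ideals, scaled by `m`, is the constant `C` up to a combination of
toggleability statistics, then words with one repeated letter are counted by words without. -/
theorem card_isWord_succ (hP : Fintype.card P = n) (m C : ℤ) (c : P → ℤ)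
    (h : ∀ I : Set P, IsLowerSet I →
      ∑ u, (if Maximal (· ∈ I) u then m + c u else 0) -
        ∑ u, (if Minimal (· ∉ I) u then c u else 0) = C) :
    m * #{σ : Fin (n + 1) → P | IsWord σ} = C * (n + 1) * #{w : Fin n → P | IsWord w} := by
  -- Sum the hypothesis over all pairs of a linear extension and one of its `n + 1` cuts.
  have hsum : ∑ x ∈ ({x | IsWord x.1} : Finset ((Fin n → P) × Fin (n + 1))),
      (∑ u, (if Maximal (· ∈ prefixSet x.1 x.2) u then m + c u else 0) -
        ∑ u, (if Minimal (· ∉ prefixSet x.1 x.2) u then c u else 0)) =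
      C * (n + 1) * #{w : Fin n → P | IsWord w} := by
    rw [sum_congr rfl fun x hx => h _ ((mem_filter.mp hx).2.isLowerSet_prefixSet x.2)]
    have : ({x | IsWord x.1} : Finset ((Fin n → P) × Fin (n + 1))) =
        ({w | IsWord w} : Finset (Fin n → P)) ×ˢ univ := by ext; simp
    rw [sum_const, this, card_product]
    simp
    ring
  rw [← hsum, sum_sub_distrib, sum_comm, sum_comm (f := fun x u => ite (Minimal _ _) _ _),
    ← sum_sub_distrib, ← sum_card_isDouble hP, Nat.cast_sum, mul_sum]
  refine sum_congr rfl fun u _ => ?_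
  -- For fixed `u` the maximal and minimal counts agree, so `c u` cancels and only the coefficient
  -- `m` survives.
  rw [← sum_filter, ← sum_filter, sum_const, sum_const, filter_filter, filter_filter,
    card_isDouble_eq_card_maximal hP, card_isDouble_eq_card_minimal hP]
  simp only [nsmul_eq_mul]
  ring

end Words

/-! ### Shifted diagrams and the corners of shifted-balanced partitions. -/

theorem mem_shiftedCells {lam : YoungDiagram} {c : ℕ × ℕ} :
    c ∈ shiftedCells lam ↔ c.1 ≤ c.2 ∧ c.2 < c.1 + lam.rowLen c.1 := by
  simp only [shiftedCells, mem_image, YoungDiagram.mem_cells]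
  constructor
  · rintro ⟨⟨i, j⟩, h, rfl⟩
    rw [YoungDiagram.mem_iff_lt_rowLen] at h
    dsimp only
    omega
  · rintro ⟨h1, h2⟩
    refine ⟨(c.1, c.2 - c.1), YoungDiagram.mem_iff_lt_rowLen.mpr (by omega), ?_⟩
    rw [Nat.add_sub_cancel' h1]

theorem card_box (lam : YoungDiagram) : Fintype.card (Box lam) = lam.card := by
  rw [Fintype.card_coe, shiftedCells, card_image_of_injective _ fun a b h => ?_]
  simp only [Prod.mk.injEq] at h
  ext <;> omega

theorem IsStrict.rowLen_succ_lt {lam : YoungDiagram} (h : IsStrict lam) {i : ℕ}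
    (hi : lam.rowLen (i + 1) ≠ 0) : lam.rowLen (i + 1) < lam.rowLen i :=
  h i fun h0 => hi (Nat.le_zero.mp (h0 ▸ lam.rowLen_anti i (i + 1) (Nat.le_succ i)))

/-- The coefficient of the toggleability statistic of the box `(i, j)` when the first part is `m`. -/
def toggleWeight (m : ℕ) (i j : ℕ) : ℤ :=
  if i = j then 2 * i - m - 1 else 2 * (i + j - m)

/-- The toggle weight of a strict partition vanishes at the inner corners outside its diagram. -/
def HasVanishingCorners (lam : YoungDiagram) : Prop :=
  ∀ i, lam.rowLen (i + 1) + 1 < lam.rowLen i →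
    toggleWeight (lam.rowLen 0) (i + 1) (i + 1 + lam.rowLen (i + 1)) = 0

theorem IsBalanced.add_eq {nu : YoungDiagram} {k : ℕ} (hnu : IsBalanced nu) (hh : height nu = k)
    (hw : width nu = k) {i : ℕ} (hi : nu.rowLen (i + 1) < nu.rowLen i) :
    nu.rowLen (i + 1) + (i + 1) = k := by
  -- The descent to an empty row is not an outward corner; there `i + 1` is the height `k` itself.
  rcases Nat.eq_zero_or_pos (nu.rowLen (i + 1)) with h0 | h0
  · have h1 : i < nu.colLen 0 := by
      rw [← YoungDiagram.mem_iff_lt_colLen, YoungDiagram.mem_iff_lt_rowLen]; omega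
    have h2 : ¬ i + 1 < nu.colLen 0 := by
      rw [← YoungDiagram.mem_iff_lt_colLen, YoungDiagram.mem_iff_lt_rowLen]; omega
    unfold height at hh
    omega
  · have h := hnu (i + 1) (nu.rowLen (i + 1)) ⟨by omega, h0, by
      rw [YoungDiagram.mem_iff_lt_rowLen]; omega, by
      rw [YoungDiagram.mem_iff_lt_rowLen]; simpa using hi, by
      rw [YoungDiagram.mem_iff_lt_rowLen]; omega⟩
    rw [hh, hw, ← mul_add] at h
    have hk : 0 < k := by
      have := nu.rowLen_anti 0 (i + 1) (Nat.zero_le _)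
      unfold width at hw
      omega
    have := Nat.eq_of_mul_eq_mul_left hk h
    omega

theorem rowLen_eq_zero_of_height_le {nu : YoungDiagram} {i : ℕ} (h : height nu ≤ i) :
    nu.rowLen i = 0 := by
  by_contra hne
  have : i < nu.colLen 0 := by
    rw [← YoungDiagram.mem_iff_lt_colLen, YoungDiagram.mem_iff_lt_rowLen]; omega
  unfold height at h
  omega

/-- Off the diagonal, the corner in row `i + 1` has coordinate sum `n + (i + 1) + ν.rowLen (i + 1) =
n + k`, which is `λ₁` for Type (1); Type (2) adds `n - 1 - k` to both sides. A diagonal corner can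
only lie in row `n`. In Type (1) it does not occur, because `k < n` makes the last part equal to 1;
in Type (2) `λ₁ = 2n - 1`, and the diagonal weight `2n - λ₁ - 1` is zero. -/
theorem hasVanishingCorners_of_isShiftedBalanced {lam : YoungDiagram}
    (h : IsShiftedBalancedOne lam ∨ IsShiftedBalancedTwo lam) : HasVanishingCorners lam := by
  intro i hi
  unfold toggleWeight
  rcases h with ⟨n, k, nu, hkn, hnu, hh, hw, hlam⟩ | ⟨n, k, nu, hkn, hnu, hh, hw, hlam⟩ <;>
  · have hz : k ≤ i → nu.rowLen i = 0 := fun h => rowLen_eq_zero_of_height_le (hh ▸ h)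
    have hz' : k ≤ i + 1 → nu.rowLen (i + 1) = 0 := fun h => rowLen_eq_zero_of_height_le (hh ▸ h)
    have hadd := hnu.add_eq (i := i) hh hw
    have h0 := hlam 0
    have h1 := hlam i
    have h2 := hlam (i + 1)
    unfold width at hw
    simp only [staircase, rectangle] at h0 h1 h2
    rw [hw] at h0
    rw [h2]
    rw [h1, h2] at hi
    rw [h0]
    clear h0 h1 h2 hlam
    grind

theorem rowLen_zero_pos_of_isShiftedBalanced {lam : YoungDiagram}
    (h : IsShiftedBalancedOne lam ∨ IsShiftedBalancedTwo lam) : 0 < lam.rowLen 0 := by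
  rcases h with ⟨n, k, nu, hkn, -, -, -, h⟩ | ⟨n, k, nu, hkn, -, -, -, h⟩ <;>
  · rw [h 0, staircase]
    omega

/-- Each row of a shifted diagram has at most one candidate for a maximal box of an ideal and one
for a minimal box of its complement, so both statistics become sums over rows. -/
theorem sum_box_ite {lam : YoungDiagram} {K : ℕ} (hK : lam.rowLen K = 0) (b : ℕ → ℕ)
    (Q : ℕ → Prop) [DecidablePred Q] (f : ℕ → ℕ → ℤ) :
    ∑ u : Box lam, (if u.1.2 = b u.1.1 ∧ Q u.1.1 then f u.1.1 u.1.2 else 0) =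
      ∑ i ∈ range K, if (i, b i) ∈ shiftedCells lam ∧ Q i then f i (b i) else 0 := by
  rw [Finset.sum_coe_sort (shiftedCells lam)
    (fun c : ℕ × ℕ => if c.2 = b c.1 ∧ Q c.1 then f c.1 c.2 else 0), ← sum_filter, ← sum_filter]
  refine sum_nbij' (fun c => c.1) (fun i => (i, b i)) ?_ ?_ ?_ ?_ ?_
  · rintro ⟨i, j⟩ h
    obtain ⟨h1, hj, h2⟩ := mem_filter.mp h
    dsimp only at hj
    refine mem_filter.mpr ⟨mem_range.mpr ?_, hj ▸ h1, h2⟩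
    by_contra hi
    have := lam.rowLen_anti K i (not_lt.mp hi)
    have := mem_shiftedCells.mp h1
    dsimp only at this
    omega
  · intro i h
    exact mem_filter.mpr ⟨(mem_filter.mp h).2.1, rfl, (mem_filter.mp h).2.2⟩
  · rintro ⟨i, j⟩ h
    obtain ⟨h1, hj, h2⟩ := mem_filter.mp h
    dsimp only at hj
    rw [hj]
  · intro i h
    rfl
  · rintro ⟨i, j⟩ h
    obtain ⟨h1, hj, h2⟩ := mem_filter.mp h
    dsimp only at hj
    rw [hj]

/-! ### Order ideals of a shifted diagram, described by their row ends. -/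

/-- `e i` is the column of the first box of row `i` outside the order ideal `I`. -/
structure IsRowEnds {lam : YoungDiagram} (I : Set (Box lam)) (e : ℕ → ℕ) : Prop where
  le : ∀ i, i ≤ e i
  le_end : ∀ i, e i ≤ i + lam.rowLen i
  mem_iff : ∀ u : Box lam, u ∈ I ↔ u.1.2 < e u.1.1
  succ_le : ∀ i, i + 1 < e (i + 1) → e (i + 1) ≤ e i

theorem exists_isRowEnds {lam : YoungDiagram} (hs : IsStrict lam) {I : Set (Box lam)}
    (hI : IsLowerSet I) : ∃ e, IsRowEnds I e := by
  classical
  have hex : ∀ i, ∃ j, i ≤ j ∧ ∀ h : (i, j) ∈ shiftedCells lam, (⟨(i, j), h⟩ : Box lam) ∉ I :=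
    fun i => ⟨i + lam.rowLen i, by omega, fun h => by simp [mem_shiftedCells] at h⟩
  have hle : ∀ i, i ≤ Nat.find (hex i) := fun i => (Nat.find_spec (hex i)).1
  have hend : ∀ i, Nat.find (hex i) ≤ i + lam.rowLen i := fun i =>
    Nat.find_min' (hex i) ⟨by omega, fun h => by simp [mem_shiftedCells] at h⟩
  have hmem : ∀ u : Box lam, u ∈ I ↔ u.1.2 < Nat.find (hex u.1.1) := by
    rintro ⟨⟨i, j⟩, hu⟩
    have hu' := mem_shiftedCells.mp hu
    dsimp only at hu' ⊢
    constructor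
    · intro h
      by_contra hlt
      have hc : (i, Nat.find (hex i)) ∈ shiftedCells lam :=
        mem_shiftedCells.mpr ⟨hle i, by dsimp only; omega⟩
      exact (Nat.find_spec (hex i)).2 hc
        (hI (Subtype.mk_le_mk.mpr (Prod.mk_le_mk.mpr ⟨le_rfl, not_lt.mp hlt⟩)) h)
    · intro h
      by_contra hn
      exact Nat.find_min (hex i) h ⟨hu'.1, fun _ => hn⟩
  -- Row ends weakly decrease only while the lower row meets `I`: an empty row has `e i = i`, which
  -- grows with `i`.
  refine ⟨fun i => Nat.find (hex i), hle, hend, hmem, fun i hi => ?_⟩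
  have h1 := hend (i + 1)
  have h2 := hs.rowLen_succ_lt (i := i) (by omega)
  have hc : (i + 1, Nat.find (hex (i + 1)) - 1) ∈ shiftedCells lam :=
    mem_shiftedCells.mpr (by dsimp only; omega)
  have hc' : (i, Nat.find (hex (i + 1)) - 1) ∈ shiftedCells lam :=
    mem_shiftedCells.mpr (by dsimp only; omega)
  have hm : (⟨_, hc⟩ : Box lam) ∈ I := (hmem _).mpr (by dsimp only; omega)
  have hm' := (hmem _).mp
    (hI (Subtype.mk_le_mk.mpr (Prod.mk_le_mk.mpr ⟨Nat.le_succ i, le_rfl⟩) : ⟨_, hc'⟩ ≤ _) hm)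
  dsimp only at hm'
  omega

section RowEnds

variable {lam : YoungDiagram} {I : Set (Box lam)} {e : ℕ → ℕ}

theorem IsRowEnds.antitone (he : IsRowEnds I e) (d i : ℕ) (h : i + d < e (i + d)) :
    e (i + d) ≤ e i := by
  induction d with
  | zero => exact le_rfl
  | succ d ih =>
    have h1 := he.succ_le (i + d) h
    exact h1.trans (ih (by rw [← add_assoc] at h; omega))

theorem IsRowEnds.maximal_iff (he : IsRowEnds I e)
    (u : Box lam) :
    Maximal (· ∈ I) u ↔ u.1.2 = e u.1.1 - 1 ∧ 0 < e u.1.1 ∧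
      ¬ (u.1.1 + 1 < e u.1.1 ∧ e u.1.1 ≤ e (u.1.1 + 1)) := by
  obtain ⟨⟨i, j⟩, hu⟩ := u
  have hu' := mem_shiftedCells.mp hu
  have hend := he.le_end i
  have hend' := he.le_end (i + 1)
  dsimp only at hu' ⊢
  constructor
  · intro h
    have h1 := (he.mem_iff _).mp h.prop
    dsimp only at h1
    have hj : j + 1 = e i := by
      by_contra hne
      have hc : (i, j + 1) ∈ shiftedCells lam := mem_shiftedCells.mpr (by dsimp only; omega)
      have := Prod.mk_le_mk.mp (h.le_of_ge (y := ⟨_, hc⟩)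
        ((he.mem_iff _).mpr (by dsimp only; omega)) (Prod.mk_le_mk.mpr ⟨le_rfl, Nat.le_succ _⟩))
      dsimp only at this
      omega
    refine ⟨by omega, by omega, fun h2 => ?_⟩
    have hc : (i + 1, j) ∈ shiftedCells lam := mem_shiftedCells.mpr (by dsimp only; omega)
    have := Prod.mk_le_mk.mp (h.le_of_ge (y := ⟨_, hc⟩)
      ((he.mem_iff _).mpr (by dsimp only; omega)) (Prod.mk_le_mk.mpr ⟨Nat.le_succ _, le_rfl⟩))
    dsimp only at this
    omega
  · rintro ⟨h1, h2, h3⟩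
    refine ⟨(he.mem_iff _).mpr (by dsimp only; omega), ?_⟩
    rintro ⟨⟨i', j'⟩, hv⟩ hvI huv
    have hv' := (he.mem_iff _).mp hvI
    have hvc := mem_shiftedCells.mp hv
    obtain ⟨hr, hc⟩ := Prod.mk_le_mk.mp (Subtype.mk_le_mk.mp huv)
    dsimp only at hv' hvc
    rcases hr.eq_or_lt with rfl | hr
    · exact Subtype.mk_le_mk.mpr (Prod.mk_le_mk.mpr ⟨le_rfl, by omega⟩)
    · obtain ⟨d, rfl⟩ := Nat.exists_eq_add_of_le (show i + 1 ≤ i' from hr)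
      have := he.antitone d (i + 1) (by omega)
      have := he.succ_le i
      omega

theorem IsRowEnds.minimal_iff (hs : IsStrict lam) (he : IsRowEnds I e) (u : Box lam) :
    Minimal (· ∉ I) u ↔ u.1.2 = e u.1.1 ∧ (u.1.1 = 0 ∨ e u.1.1 < e (u.1.1 - 1)) := by
  obtain ⟨⟨i, j⟩, hu⟩ := u
  have hu' := mem_shiftedCells.mp hu
  have hle := he.le i
  dsimp only at hu' ⊢
  constructor
  · intro h
    have h1 := mt (he.mem_iff _).mpr h.prop
    dsimp only at h1
    have hj : j = e i := by
      by_contra hne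
      have hc : (i, j - 1) ∈ shiftedCells lam := mem_shiftedCells.mpr (by dsimp only; omega)
      have := Prod.mk_le_mk.mp (h.le_of_le (y := ⟨_, hc⟩)
        (mt (he.mem_iff _).mp (by dsimp only; omega)) (Prod.mk_le_mk.mpr ⟨le_rfl, Nat.sub_le _ _⟩))
      dsimp only at this
      omega
    refine ⟨hj, or_iff_not_imp_left.mpr fun h0 => ?_⟩
    by_contra h2
    obtain ⟨i, rfl⟩ := Nat.exists_eq_succ_of_ne_zero h0
    simp only [Nat.succ_eq_add_one, Nat.add_sub_cancel] at *
    have := hs.rowLen_succ_lt (i := i) (by omega)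
    have hc : (i, j) ∈ shiftedCells lam := mem_shiftedCells.mpr (by dsimp only; omega)
    have := Prod.mk_le_mk.mp (h.le_of_le (y := ⟨_, hc⟩)
      (mt (he.mem_iff _).mp (by dsimp only; omega)) (Prod.mk_le_mk.mpr ⟨Nat.le_succ _, le_rfl⟩))
    dsimp only at this
    omega
  · rintro ⟨h1, h2⟩
    refine ⟨mt (he.mem_iff _).mp (by dsimp only; omega), ?_⟩
    rintro ⟨⟨i', j'⟩, hv⟩ hvI huv
    have hv' := mt (he.mem_iff _).mpr hvI
    have hvc := mem_shiftedCells.mp hv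
    obtain ⟨hr, hc⟩ := Prod.mk_le_mk.mp (Subtype.mk_le_mk.mp huv)
    dsimp only at hv' hvc
    rcases hr.eq_or_lt with rfl | hr
    · exact Subtype.mk_le_mk.mpr (Prod.mk_le_mk.mpr ⟨le_rfl, by omega⟩)
    · obtain ⟨d, rfl⟩ := Nat.exists_eq_add_of_le (show i' + 1 ≤ i from hr)
      rw [show i' + 1 + d - 1 = i' + d by omega] at h2
      have := he.antitone d i' (by omega)
      omega

-- The maximal box at the end of row `i` is paired with the minimal box after the end of row `i +
-- 1`. Off the diagonal, when `e (i + 1) < e i`, the weights contribute `2 * (e i - e (i + 1))`, so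
-- the sum telescopes; the diagonal weight is the one that keeps this true where a row of `I`
-- becomes empty.
open Classical in
theorem sum_maximal_sub_sum_minimal (hs : IsStrict lam) (hv : HasVanishingCorners lam)
    (h0 : 0 < lam.rowLen 0) (hI : IsLowerSet I) :
    ∑ u : Box lam, (if Maximal (· ∈ I) u then 4 + toggleWeight (lam.rowLen 0) u.1.1 u.1.2 else 0) -
        ∑ u : Box lam,
          (if Minimal (· ∉ I) u then toggleWeight (lam.rowLen 0) u.1.1 u.1.2 else 0) =
      lam.rowLen 0 + 1 := by
  obtain ⟨e, he⟩ := exists_isRowEnds hs hI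
  obtain ⟨K, hK⟩ : ∃ K, lam.rowLen K = 0 := ⟨lam.colLen 0, by
    by_contra hne
    have := YoungDiagram.mem_iff_lt_colLen.mp
      (YoungDiagram.mem_iff_lt_rowLen.mpr (Nat.pos_of_ne_zero hne))
    exact lt_irrefl _ this⟩
  have hK' : lam.rowLen (K + 1) = 0 := Nat.le_zero.mp (hK ▸ lam.rowLen_anti K (K + 1) (by omega))
  simp only [he.maximal_iff, he.minimal_iff hs]
  rw [sum_box_ite hK (fun i => e i - 1) (fun i => 0 < e i ∧ ¬ (i + 1 < e i ∧ e i ≤ e (i + 1)))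
      (fun i j => 4 + toggleWeight (lam.rowLen 0) i j),
    sum_box_ite hK' e (fun i => i = 0 ∨ e i < e (i - 1)), sum_range_succ', ← sub_sub,
    ← sum_sub_distrib]
  -- The potential of the telescoping; rows not meeting `I` all get the constant `λ₁ - 1`.
  let Φ : ℕ → ℤ := fun i => if i < e i then 2 * e i else lam.rowLen 0 - 1
  have hstep : ∀ i, (if (i, e i - 1) ∈ shiftedCells lam ∧ 0 < e i ∧
        ¬ (i + 1 < e i ∧ e i ≤ e (i + 1)) then 4 + toggleWeight (lam.rowLen 0) i (e i - 1) else 0) -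
      (if (i + 1, e (i + 1)) ∈ shiftedCells lam ∧ (i + 1 = 0 ∨ e (i + 1) < e (i + 1 - 1)) then
        toggleWeight (lam.rowLen 0) (i + 1) (e (i + 1)) else 0) = Φ i - Φ (i + 1) := by
    intro i
    have h1 := he.le i
    have h2 := he.le (i + 1)
    have h3 := he.le_end i
    have h4 := he.le_end (i + 1)
    have h5 := he.succ_le i
    -- Membership in the diagram may be dropped: if row `i + 1` lies entirely in `I` and `e (i + 1)
    -- < e i`, the box after it is an addable corner of `λ`, and its weight vanishes. This is the
    -- only use of `hv`.
    have h6 : (if (i + 1, e (i + 1)) ∈ shiftedCells lam ∧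
        (i + 1 = 0 ∨ e (i + 1) < e (i + 1 - 1)) then
          toggleWeight (lam.rowLen 0) (i + 1) (e (i + 1)) else 0) =
        if e (i + 1) < e i then toggleWeight (lam.rowLen 0) (i + 1) (e (i + 1)) else 0 := by
      simp only [mem_shiftedCells, Nat.add_sub_cancel, Nat.succ_ne_zero, false_or]
      have h7 := hv i
      rcases h4.eq_or_lt with h8 | h8
      · rw [← h8] at h7
        by_cases h9 : e (i + 1) < e i
        · rw [h7 (by omega)]
          simp
        · simp [h9]
      · simp [h2, h8]
    have h7 : i + 1 < e (i + 1) → i + 1 < e i := by omega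
    have h8 : ((i, e i - 1) ∈ shiftedCells lam ∧ 0 < e i ∧
        ¬ (i + 1 < e i ∧ e i ≤ e (i + 1))) ↔ i < e i ∧ ¬ (i + 1 < e i ∧ e i ≤ e (i + 1)) := by
      rw [mem_shiftedCells]
      dsimp only
      omega
    rw [h6]
    simp only [h8]
    simp only [Φ]
    clear h6 h8
    generalize e i = a at *
    generalize e (i + 1) = b at *
    unfold toggleWeight
    split_ifs <;> push_cast <;> omega
  rw [sum_congr rfl fun i _ => hstep i, sum_range_sub']
  have h1 := he.le_end 0
  have h2 := he.le_end K
  have h3 := he.le K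
  have h4 : e K = K := by omega
  -- What remains is `Φ 0 - (λ₁ - 1)` minus the minimal term of row 0, which had no row above to
  -- pair with. It equals `λ₁ + 1` whether row 0 of `I` is empty, partial or full.
  simp only [Φ, h4, mem_shiftedCells, toggleWeight, true_or, and_true]
  split_ifs <;> omega

end RowEnds

/-! ### Standard tableaux as words with free primes. -/

section Fillings

variable {lam : YoungDiagram} {N : ℕ}

/-- The entry `i + 1`, primed if `ε i` is true. -/
def entryAt (ε : Fin N → Bool) (i : Fin N) : Entry := toLex (i.val.succPNat, ε i)

theorem val_entryAt (ε : Fin N → Bool) (i : Fin N) : (entryAt ε i).val = i.val.succPNat := rfl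

theorem val_entryAt_inj {ε ε' : Fin N → Bool} {i j : Fin N}
    (h : (entryAt ε i).val = (entryAt ε' j).val) : i = j :=
  Fin.ext (Nat.succPNat_injective h)

theorem Entry.val_le_val {a b : Entry} (h : a ≤ b) : a.val ≤ b.val :=
  Prod.Lex.monotone_fst a b h

theorem entryAt_lt_entryAt (ε : Fin N → Bool) {i j : Fin N} (h : i < j) :
    entryAt ε i < entryAt ε j :=
  Prod.Lex.toLex_lt_toLex.mpr (Or.inl (Nat.succPNat_strictMono h))

open Classical in
/-- The filling whose entries have the integer `i + 1` in box `σ i`, primed according to `ε`. -/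
noncomputable def fillingOfWord (σ : Fin N → Box lam) (ε : Fin N → Bool) : Filling lam :=
  fun u => ({i | σ i = u} : Finset (Fin N)).image (entryAt ε)

theorem mem_fillingOfWord {σ : Fin N → Box lam} {ε : Fin N → Bool} {u : Box lam} {e : Entry} :
    e ∈ fillingOfWord σ ε u ↔ ∃ i, σ i = u ∧ entryAt ε i = e := by
  classical
  simp [fillingOfWord]

theorem isTableau_fillingOfWord {σ : Fin N → Box lam} (hσ : IsWord σ) (ε : Fin N → Bool) :
    IsTableau (fillingOfWord σ ε) := by
  have huniq : ∀ (e : Entry) (u v : Box lam), e ∈ fillingOfWord σ ε u →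
      e ∈ fillingOfWord σ ε v → u = v := by
    intro e u v hu hv
    obtain ⟨i, rfl, rfl⟩ := mem_fillingOfWord.mp hu
    obtain ⟨j, rfl, hj⟩ := mem_fillingOfWord.mp hv
    rw [val_entryAt_inj (congrArg Entry.val hj)]
  refine ⟨fun u => ?_, fun u v huv a ha b hb => ?_, fun e _ u v _ => huniq e u v,
    fun e _ u v _ => huniq e u v⟩
  · obtain ⟨i, rfl⟩ := hσ.1 u
    exact ⟨_, mem_fillingOfWord.mpr ⟨i, rfl, rfl⟩⟩
  · obtain ⟨i, rfl, rfl⟩ := mem_fillingOfWord.mp ha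
    obtain ⟨j, rfl, rfl⟩ := mem_fillingOfWord.mp hb
    rcases lt_trichotomy i j with h | rfl | h
    · exact (entryAt_lt_entryAt ε h).le
    · exact le_rfl
    · exact absurd huv (hσ.2 _ _ h)

theorem content_fillingOfWord (σ : Fin N → Box lam) (ε : Fin N → Bool) :
    content (fillingOfWord σ ε) = prodContent N := by
  classical
  have h : ∀ u, ∑ e ∈ fillingOfWord σ ε u, (Finsupp.single e.val 1 : ℕ+ →₀ ℕ) =
      ∑ i ∈ ({i | σ i = u} : Finset (Fin N)), Finsupp.single i.val.succPNat 1 := by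
    intro u
    rw [fillingOfWord, sum_image fun i _ j _ hij => val_entryAt_inj (congrArg Entry.val hij)]
    rfl
  rw [content, sum_congr rfl fun u _ => h u, sum_fiberwise, prodContent,
    Fin.sum_univ_eq_sum_range (fun i => (Finsupp.single i.succPNat 1 : ℕ+ →₀ ℕ))]

theorem fillingOfWord_injective :
    Injective fun p : (Fin N → Box lam) × (Fin N → Bool) => fillingOfWord p.1 p.2 := by
  rintro ⟨σ, ε⟩ ⟨σ', ε'⟩ h
  have key : ∀ i, σ' i = σ i ∧ ε' i = ε i := by
    intro i
    have hi : entryAt ε i ∈ fillingOfWord σ' ε' (σ i) := by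
      rw [← show fillingOfWord σ ε = fillingOfWord σ' ε' from h]
      exact mem_fillingOfWord.mpr ⟨i, rfl, rfl⟩
    obtain ⟨j, hj, hji⟩ := mem_fillingOfWord.mp hi
    obtain rfl := val_entryAt_inj (congrArg Entry.val hji)
    exact ⟨hj, congrArg (fun e : Entry => (ofLex e).2) hji⟩
  exact Prod.ext (funext fun i => (key i).1.symm) (funext fun i => (key i).2.symm)

theorem isUnprimed_fillingOfWord_iff {σ : Fin N → Box lam} {ε : Fin N → Bool} :
    IsUnprimed (fillingOfWord σ ε) ↔ ε = fun _ => false := by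
  constructor
  · intro h
    funext i
    exact eq_false_of_ne_true (h _ _ (mem_fillingOfWord.mpr ⟨i, rfl, rfl⟩))
  · rintro rfl u e he
    obtain ⟨i, rfl, rfl⟩ := mem_fillingOfWord.mp he
    exact Bool.false_ne_true

theorem content_apply (T : Filling lam) (m : ℕ+) :
    content T m = #{x ∈ univ.sigma T | x.2.val = m} := by
  rw [content, sum_sigma', Finsupp.finsetSum_apply, card_filter]
  simp only [Finsupp.single_apply]

theorem prodContent_apply (m : ℕ+) : prodContent N m = if m.natPred < N then 1 else 0 := by
  have h : ∀ i : ℕ, i.succPNat = m ↔ m.natPred = i := fun i =>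
    ⟨fun h => h ▸ Nat.natPred_succPNat i, fun h => h ▸ PNat.succPNat_natPred m⟩
  simp only [prodContent, Finsupp.finsetSum_apply, Finsupp.single_apply, h]
  simp

/-- The content says that each integer up to `N` sits in exactly one box with exactly one prime
flag, and no other integer occurs; reading these off gives `σ` and `ε`. -/
theorem exists_fillingOfWord_eq {T : Filling lam} (hT : IsTableau T)
    (hc : content T = prodContent N) : ∃ σ ε, IsWord σ ∧ fillingOfWord (N := N) σ ε = T := by
  have hone : ∀ i : Fin N, ∃ x : Σ _ : Box lam, Entry,
      ({x ∈ univ.sigma T | x.2.val = i.val.succPNat} : Finset _) = {x} := by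
    intro i
    rw [← card_eq_one, ← content_apply, hc, prodContent_apply, Nat.natPred_succPNat,
      if_pos i.isLt]
  choose x hx using hone
  have hmem : ∀ i, (x i).2 ∈ T (x i).1 ∧ (x i).2.val = i.val.succPNat := by
    intro i
    have := hx i ▸ mem_singleton_self (x i)
    simpa using this
  have huniq : ∀ u, ∀ e ∈ T u, ∃ i, x i = ⟨u, e⟩ := by
    intro u e he
    have hpos : 0 < content T e.val := by
      rw [content_apply]
      exact card_pos.mpr ⟨⟨u, e⟩, by simp [he]⟩
    rw [hc, prodContent_apply] at hpos
    have hlt : e.val.natPred < N := by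
      by_contra h
      simp [h] at hpos
    refine ⟨⟨e.val.natPred, hlt⟩, ?_⟩
    have : (⟨u, e⟩ : Σ _ : Box lam, Entry) ∈
        ({x ∈ univ.sigma T | x.2.val = e.val.natPred.succPNat} : Finset _) := by simp [he]
    exact (mem_singleton.mp (hx ⟨e.val.natPred, hlt⟩ ▸ this)).symm
  have hentry : ∀ i, entryAt (fun i => (ofLex (x i).2).2) i = (x i).2 := by
    intro i
    rw [entryAt, ← (hmem i).2]
    rfl
  refine ⟨fun i => (x i).1, fun i => (ofLex (x i).2).2, ⟨fun u => ?_, fun i j hij hlt => ?_⟩, ?_⟩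
  · obtain ⟨e, he⟩ := hT.nonempty u
    obtain ⟨i, hi⟩ := huniq u e he
    exact ⟨i, congrArg Sigma.fst hi⟩
  · have := Entry.val_le_val (hT.max_le_min _ _ hlt _ (hmem j).1 _ (hmem i).1)
    rw [(hmem i).2, (hmem j).2] at this
    exact absurd (Nat.succPNat_strictMono (Fin.lt_def.mp hij)) (not_lt.mpr this)
  · funext u
    ext e
    rw [mem_fillingOfWord]
    constructor
    · rintro ⟨i, rfl, rfl⟩
      rw [hentry]
      exact (hmem i).1
    · intro he
      obtain ⟨i, hi⟩ := huniq u e he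
      exact ⟨i, congrArg Sigma.fst hi, by rw [hentry, hi]⟩

open Classical in
theorem ncard_isTableau_content_eq (lam : YoungDiagram) (N : ℕ) :
    {T : Filling lam | IsTableau T ∧ content T = prodContent N}.ncard =
      #{σ : Fin N → Box lam | IsWord σ} * 2 ^ N := by
  have : {T : Filling lam | IsTableau T ∧ content T = prodContent N} =
      (fun p : (Fin N → Box lam) × (Fin N → Bool) => fillingOfWord p.1 p.2) ''
        ↑(({σ | IsWord σ} : Finset (Fin N → Box lam)) ×ˢ (univ : Finset (Fin N → Bool))) := by
    ext T
    simp only [Set.mem_ofPred_eq, Set.mem_image, mem_coe, mem_product, mem_filter, mem_univ,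
      true_and, and_true, Prod.exists]
    constructor
    · rintro ⟨hT, hc⟩
      exact exists_fillingOfWord_eq hT hc
    · rintro ⟨σ, ε, hσ, rfl⟩
      exact ⟨isTableau_fillingOfWord hσ ε, content_fillingOfWord σ ε⟩
  rw [this, Set.ncard_image_of_injective _ fillingOfWord_injective, Set.ncard_coe_finset,
    card_product]
  simp

open Classical in
theorem ncard_isTableau_content_eq_isUnprimed (lam : YoungDiagram) (N : ℕ) :
    {T : Filling lam | IsTableau T ∧ content T = prodContent N ∧ IsUnprimed T}.ncard =
      #{σ : Fin N → Box lam | IsWord σ} := by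
  have : {T : Filling lam | IsTableau T ∧ content T = prodContent N ∧ IsUnprimed T} =
      (fun σ : Fin N → Box lam => fillingOfWord σ fun _ => false) ''
        ({σ | IsWord σ} : Finset (Fin N → Box lam)) := by
    ext T
    simp only [Set.mem_ofPred_eq, Set.mem_image, mem_coe, mem_filter, mem_univ, true_and]
    constructor
    · rintro ⟨hT, hc, hu⟩
      obtain ⟨σ, ε, hσ, rfl⟩ := exists_fillingOfWord_eq hT hc
      obtain rfl := isUnprimed_fillingOfWord_iff.mp hu
      exact ⟨σ, hσ, rfl⟩
    · rintro ⟨σ, hσ, rfl⟩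
      exact ⟨isTableau_fillingOfWord hσ _, content_fillingOfWord σ _,
        isUnprimed_fillingOfWord_iff.mpr rfl⟩
  rw [this, Set.ncard_image_of_injective _ fun σ σ' h =>
    congrArg Prod.fst (fillingOfWord_injective (a₁ := (σ, _)) (a₂ := (σ', _)) h),
    Set.ncard_coe_finset]

theorem degree_content (T : Filling lam) : (content T).degree = ∑ u, #(T u) := by
  simp [content, map_sum]

theorem degree_prodContent (N : ℕ) : (prodContent N).degree = N := by
  simp [prodContent, map_sum]

theorem isStandard_and_isSingleValued_iff {T : Filling lam} (hT : IsTableau T) :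
    IsStandard T ∧ IsSingleValued T ↔ content T = prodContent lam.card := by
  have hdeg := degree_content T
  constructor
  · rintro ⟨⟨N, hN⟩, hs⟩
    rw [hN, degree_prodContent, sum_congr rfl fun u _ => hs u] at hdeg
    simp only [sum_const, card_univ, card_box, smul_eq_mul, mul_one] at hdeg
    rw [hN, hdeg]
  · intro h
    refine ⟨⟨_, h⟩, fun u => ?_⟩
    rw [h, degree_prodContent, ← card_box, ← card_univ, card_eq_sum_ones] at hdeg
    exact ((sum_eq_sum_iff_of_le fun u _ => card_pos.mpr (hT.nonempty u)).mp hdeg u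
      (mem_univ u)).symm

/-- A degree count: boxes are nonempty, so total degree `|λ| + 1` leaves room for exactly one extra
entry. -/
theorem isStandard_and_isBarelySetValued_iff {T : Filling lam} (hT : IsTableau T) :
    IsStandard T ∧ IsBarelySetValued T ↔ content T = prodContent (lam.card + 1) := by
  classical
  have hdeg := degree_content T
  constructor
  · rintro ⟨⟨N, hN⟩, u, hu, hs⟩
    rw [hN, degree_prodContent, ← add_sum_erase _ _ (mem_univ u), hu,
      sum_congr rfl fun v hv => hs v (ne_of_mem_erase hv)] at hdeg
    have hpos := card_pos.mpr ⟨u, mem_univ u⟩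
    simp only [sum_const, card_erase_of_mem (mem_univ u), smul_eq_mul, mul_one] at hdeg
    rw [card_univ, card_box] at hdeg hpos
    rw [hN, show N = lam.card + 1 by omega]
  · intro h
    rw [h, degree_prodContent] at hdeg
    have hone : ∀ u, 1 ≤ #(T u) := fun u => card_pos.mpr (hT.nonempty u)
    have hcard : ∑ _u : Box lam, 1 = lam.card := by rw [← card_box]; simp
    obtain ⟨u, -, hu⟩ : ∃ u ∈ univ, 1 < #(T u) := exists_lt_of_sum_lt (by omega)
    rw [← add_sum_erase _ _ (mem_univ u)] at hdeg hcard
    have hle : ∑ v ∈ univ.erase u, 1 ≤ ∑ v ∈ univ.erase u, #(T v) :=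
      sum_le_sum fun v _ => hone v
    refine ⟨⟨_, h⟩, u, by omega, fun v hv => ?_⟩
    have heq : ∑ v ∈ univ.erase u, 1 = ∑ v ∈ univ.erase u, #(T v) := by omega
    exact ((sum_eq_sum_iff_of_le fun v _ => hone v).mp heq v
      (mem_erase.mpr ⟨hv, mem_univ v⟩)).symm

open Classical in
theorem numBarely_eq (lam : YoungDiagram) :
    numBarely lam = #{σ : Fin (lam.card + 1) → Box lam | IsWord σ} * 2 ^ (lam.card + 1) := by
  rw [← ncard_isTableau_content_eq, numBarely]
  congr 1
  ext T
  exact and_congr_right isStandard_and_isBarelySetValued_iff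

open Classical in
theorem numUnprimed_eq (lam : YoungDiagram) :
    numUnprimed lam = #{σ : Fin lam.card → Box lam | IsWord σ} := by
  rw [← ncard_isTableau_content_eq_isUnprimed, numUnprimed]
  congr 1
  ext T
  refine and_congr_right fun hT => ?_
  rw [← and_assoc, isStandard_and_isSingleValued_iff hT]

/-- Every tableau with this content has excess degree 1, so all signs are `-1`. Balancedness plays
no role here. -/
theorem coeff_GQ_eq (lam : YoungDiagram) :
    MvPowerSeries.coeff (prodContent (lam.card + 1)) (GQ lam) = -(numBarely lam : ℤ) := by
  have h : MvPowerSeries.coeff (prodContent (lam.card + 1)) (GQ lam) =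
      ∑ T ∈ (finite_content_eq lam (prodContent (lam.card + 1))).toFinset,
        (-1) ^ ((content T).degree - lam.card) := rfl
  have hset : {T : Filling lam | IsTableau T ∧ IsStandard T ∧ IsBarelySetValued T} =
      {T : Filling lam | IsTableau T ∧ content T = prodContent (lam.card + 1)} := by
    ext T
    exact and_congr_right isStandard_and_isBarelySetValued_iff
  rw [h, sum_congr rfl (g := fun _ => (-1 : ℤ)), numBarely, hset,
    Set.ncard_eq_toFinset_card _ (finite_content_eq lam _)]
  · simp
  · intro T hT
    rw [((Set.Finite.mem_toFinset _).mp hT).2, degree_prodContent]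
    simp

end Fillings

end ShiftedTableaux

/-! ### The enumeration. -/

theorem mainTheorem12 (lam : YoungDiagram) (hstrict : ShiftedTableaux.IsStrict lam)
    (hbal : ShiftedTableaux.IsShiftedBalancedOne lam ∨
      ShiftedTableaux.IsShiftedBalancedTwo lam) :
    ShiftedTableaux.numBarely lam =
        (lam.rowLen 0 + 1) * (lam.card + 1) * 2 ^ (lam.card - 1) *
          ShiftedTableaux.numUnprimed lam ∧
      MvPowerSeries.coeff (ShiftedTableaux.prodContent (lam.card + 1))
          (ShiftedTableaux.GQ lam) =
        -(ShiftedTableaux.numBarely lam : ℤ) := by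
  classical
  refine ⟨?_, ShiftedTableaux.coeff_GQ_eq lam⟩
  have h0 := ShiftedTableaux.rowLen_zero_pos_of_isShiftedBalanced hbal
  -- Nonemptiness is needed because the exponent `lam.card - 1` is a truncated subtraction.
  have hpos : 0 < lam.card :=
    Finset.card_pos.mpr ⟨(0, 0), YoungDiagram.mem_iff_lt_rowLen.mpr h0⟩
  have key := ShiftedTableaux.card_isWord_succ (ShiftedTableaux.card_box lam) 4 _ _ fun I hI =>
    ShiftedTableaux.sum_maximal_sub_sum_minimal hstrict
      (ShiftedTableaux.hasVanishingCorners_of_isShiftedBalanced hbal) h0 hI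
  rw [ShiftedTableaux.numBarely_eq, ShiftedTableaux.numUnprimed_eq]
  have hpow : 2 ^ (lam.card + 1) = 4 * 2 ^ (lam.card - 1) := by
    rw [show lam.card + 1 = lam.card - 1 + 2 by omega, pow_add]
    ring
  have key' := (by exact_mod_cast key :
    4 * (Finset.univ.filter fun σ : Fin (lam.card + 1) → ShiftedTableaux.Box lam =>
      ShiftedTableaux.IsWord σ).card = (lam.rowLen 0 + 1) * (lam.card + 1) *
        (Finset.univ.filter fun σ : Fin lam.card → ShiftedTableaux.Box lam =>
          ShiftedTableaux.IsWord σ).card)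
  rw [hpow, mul_left_comm, ← mul_assoc, key']
  ring
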